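/- Let $S$ be a Borel subset of a Polish space (equivalently, up to homeomorphism, a separable metrizable space whose Borel $\sigma$-field is standard), with Borel $\sigma$-field $\mathcal B$, and let $X=(X_1,X_2,\ldots)$ be a sequence of $S$-valued random variables on a probability space $(\Omega,\mathcal A,P)$. Put $\mathcal F_0=\{\emptyset,\Omega\}$ and $\mathcal F_n=\sigma(X_1,\ldots,X_n)$, and for $n\ge 0$ let $\alpha_n(\cdot)=P(X_{n+1}\in\cdot\mid\mathcal F_n)$ be the (regular) predictive distribution. For a random probability measure $\alpha$ on $\mathcal B$ (a map $\omega\mapsto\alpha(\omega,\cdot)$ into the probability measures on $\mathcal B$ such that $\omega\mapsto\alpha(\omega,B)$ is $\mathcal A$-measurable for each $B\in\mathcal B$) and a bounded Borel function $f$ on $S$, write $\alpha(f)=\int f\,d\alpha$. Suppose that, for every bounded continuous $f:S\to\mathbb R$, the sequence $\alpha_n(f)$ converges in probability as $n\to\infty$. Then $X$ is asymptotically exchangeable, that is, there is an exchangeable sequence $(Z_1,Z_2,\ldots)$ such that $(X_{n+1},X_{n+2},\ldots)\to(Z_1,Z_2,\ldots)$ in distribution (on $S^{\mathbb N}$ with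 the product topology) as $n\to\infty$. More precisely, there is a random probability measure $\alpha$ on $\mathcal B$ with $\alpha_n(f)\to\alpha(f)$ in probability for every bounded continuous $f$; and for every such $\alpha$, the sequence $(X_{n+1},X_{n+2},\ldots)$ converges in distribution to an exchangeable sequence $(Z_1,Z_2,\ldots)$ whose law is the mixture of i.i.d. laws directed by $\alpha$: $$P(Z_1\in B_1,\ldots,Z_k\in B_k)=E\Bigl\{\prod_{j=1}^k\alpha(B_j)\Bigr\}\qquad\text{for all }k\ge 1\text{ and }B_1,\ldots,B_k\in\mathcal B.$$ -/

import Mathlib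

open MeasureTheory ProbabilityTheory Filter
open scoped BoundedContinuousFunction

universe u v

/-- The predictive distributions of a sequence `X 0, X 1, …` (zero-based indexing): `predictive P X n ω`
is the regular conditional distribution of `X n`, the `(n + 1)`-st term, given the first `n` terms
`X 0, …, X (n - 1)`, evaluated at the values that these take at `ω`. For `n = 0` one conditions on
the trivial `σ`-field. -/
noncomputable def predictive {Ω : Type v} [MeasurableSpace Ω] {S : Type u} [MeasurableSpace S]
    [StandardBorelSpace S] [Nonempty S] (P : Measure Ω) [IsFiniteMeasure P] (X : ℕ → Ω → S)
    (n : ℕ) (ω : Ω) : Measure S :=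
  condDistrib (X n) (fun (ω' : Ω) (i : Fin n) => X i ω') P (fun i : Fin n => X i ω)

/-- For each bounded continuous `f`, the random variables `α_n(f) = ∫ f dα_n` converge in
probability to some real random variable (which may depend on `f`); here `α_n` is the `n`-th
predictive distribution. -/
def PredictivesConverge {Ω : Type v} [MeasurableSpace Ω] {S : Type u} [MeasurableSpace S]
    [TopologicalSpace S] [StandardBorelSpace S] [Nonempty S] (P : Measure Ω) [IsFiniteMeasure P]
    (X : ℕ → Ω → S) : Prop :=
  ∀ f : S →ᵇ ℝ, ∃ g : Ω → ℝ, Measurable g ∧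
    TendstoInMeasure P (fun (n : ℕ) (ω : Ω) => ∫ x, f x ∂(predictive P X n ω)) atTop g

/-- The random probability measure `α` is the limit of the predictive distributions:
`α_n(f) → α(f)` in probability for every bounded continuous `f`. -/
def IsPredictiveLimit {Ω : Type v} [MeasurableSpace Ω] {S : Type u} [MeasurableSpace S]
    [TopologicalSpace S] [StandardBorelSpace S] [Nonempty S] (P : Measure Ω) [IsFiniteMeasure P]
    (X : ℕ → Ω → S) (α : Kernel Ω S) : Prop :=
  ∀ f : S →ᵇ ℝ,
    TendstoInMeasure P (fun (n : ℕ) (ω : Ω) => ∫ x, f x ∂(predictive P X n ω)) atTop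
      (fun ω => ∫ x, f x ∂(α ω))

/-- A sequence is exchangeable if the joint law of its first `n` terms is invariant under all
permutations of them, for every `n`. -/
def Exchangeable {Ω : Type v} [MeasurableSpace Ω] {S : Type u} [MeasurableSpace S]
    (Q : Measure Ω) (Z : ℕ → Ω → S) : Prop :=
  ∀ (n : ℕ) (σ : Equiv.Perm (Fin n)),
    IdentDistrib (fun (ω : Ω) (i : Fin n) => Z (σ i) ω) (fun (ω : Ω) (i : Fin n) => Z i ω) Q Q

/-- `X` is asymptotically exchangeable: the shifted sequences `(X n, X (n + 1), …)` converge in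
distribution, as random elements of `S^ℕ` with the product topology, to an exchangeable sequence. -/
def AsymptoticallyExchangeable {Ω : Type v} [MeasurableSpace Ω] {S : Type u} [MeasurableSpace S]
    [TopologicalSpace S] [SecondCountableTopology S] [BorelSpace S]
    (P : Measure Ω) [IsProbabilityMeasure P] (X : ℕ → Ω → S) : Prop :=
  ∃ (Ω' : Type u) (_ : MeasurableSpace Ω') (Q : Measure Ω') (_ : IsProbabilityMeasure Q)
    (Z : ℕ → Ω' → S), Exchangeable Q Z ∧
      TendstoInDistribution (fun (n : ℕ) (ω : Ω) (i : ℕ) => X (n + i) ω) atTop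
        (fun (ω' : Ω') (i : ℕ) => Z i ω') (fun _ => P) Q

/-- The law of the sequence `Z` is the mixture, directed by the random probability measure `α`, of
the laws of i.i.d. sequences:
`Q (Z 0 ∈ B 0, …, Z (k - 1) ∈ B (k - 1)) = E (α(B 0) ⋯ α(B (k - 1)))`. -/
def IsIIDMixture {Ω : Type v} [MeasurableSpace Ω] {Ω' : Type u} [MeasurableSpace Ω'] {S : Type u}
    [MeasurableSpace S] (P : Measure Ω) (α : Kernel Ω S) (Q : Measure Ω') (Z : ℕ → Ω' → S) : Prop :=
  ∀ (k : ℕ) (B : Fin k → Set S), (∀ i, MeasurableSet (B i)) →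
    Q {ω' | ∀ i : Fin k, Z i ω' ∈ B i} = ∫⁻ ω, ∏ i : Fin k, α ω (B i) ∂P

/-! Convergence of the shifts is a moment computation. Given the first `n + k` terms, the
expectation of `f (X (n + k))` is the integral of `f` against the predictive distribution at time `n
+ k`. This is `L¹`-close to the one at time `n`, since both approach `α(f)`. The latter depends only
on the first `n` terms, so it can be carried as a weight while the remaining factors are removed in
the same way. Hence the moments of the shifts tend to `E ∏ α(f_j)`
(`IsPredictiveLimit.tendsto_integral_mul_prod`), the moments of the i.i.d. mixture. Embedding `S` in
the Hilbert cube and applying Stone–Weierstrass shows that such moments decide weak convergence on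
`ℕ → S` (`tendsto_probabilityMeasure_pi`).

For the existence of `α`, separability of the continuous functions on the cube and compactness give
a subsequence along which the predictives converge weakly, almost surely, to a random measure on the
cube. It could charge points outside `S`. Its mean is the weak limit of the laws of `X n`, whose
integrals converge for every bounded continuous function on `S`, not only for those extending to the
cube. Mass escaping from `S` would allow a gliding-hump function with oscillating integrals
(`exists_not_tendsto_integral_of_escaping_mass`). So the mean, and hence almost every realization,
lives on `S`. -/

open Topology Set

/-! ### Weak convergence and escaping mass -/

/-- Weak convergence of probability measures can be tested after an inducing map. -/
lemma tendsto_probabilityMeasure_of_tendsto_map {S K : Type*} [TopologicalSpace S]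
    [MeasurableSpace S] [BorelSpace S] [TopologicalSpace K]
    [MeasurableSpace K] [BorelSpace K] [HasOuterApproxClosed K] {ι : S → K} (hι : IsInducing ι)
    {μs : ℕ → ProbabilityMeasure S} {μ : ProbabilityMeasure S}
    (h : Tendsto (fun n => (μs n).map hι.continuous.measurable.aemeasurable) atTop
      (𝓝 (μ.map hι.continuous.measurable.aemeasurable))) :
    Tendsto μs atTop (𝓝 μ) := by
  refine tendsto_of_forall_isOpen_le_liminf_nat' fun G hG => ?_
  obtain ⟨U, hU, rfl⟩ := hι.isOpen_iff.1 hG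
  have := ProbabilityMeasure.le_liminf_measure_open_of_tendsto h hU
  simpa [ProbabilityMeasure.toMeasure_map,
    Measure.map_apply hι.continuous.measurable hU.measurableSet] using this

/-- If mass `c > 0` of a sequence of probability measures escapes to the missing boundary `r = 0`,
then some bounded continuous function has integrals that do not converge. -/
lemma exists_not_tendsto_integral_of_escaping_mass {S : Type*} [TopologicalSpace S] [NormalSpace S]
    [MeasurableSpace S] [OpensMeasurableSpace S] (μ : ℕ → Measure S)
    [∀ n, IsProbabilityMeasure (μ n)] {r : S → ℝ} (hr : Continuous r) (hpos : ∀ x, 0 < r x)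
    {c : ℝ} (hc : 0 < c)
    (hup : ∀ ε > 0, ∃ δ > 0, ∀ᶠ n in atTop, (μ n).real {x | r x ≤ δ} < c + ε)
    (hlow : ∀ t > 0, ∀ ε > 0, ∀ᶠ n in atTop, c - ε < (μ n).real {x | r x < t}) :
    ∃ f : S →ᵇ ℝ, ∀ l, ¬ Tendsto (fun n => ∫ x, f x ∂μ n) atTop (𝓝 l) := by
  -- The two subsequences below give `c - 2 * ε ≤ l ≤ 3 * ε`, which is impossible once `5 * ε < c`.
  set ε := c / 10 with hε
  have hε0 : 0 < ε := by positivity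
  obtain ⟨δ, hδ, hupδ⟩ := hup ε hε0
  -- An annulus `s ≤ r ≤ t` captures nearly all of the mass near the boundary. The hypothesis `0 <
  -- t` sits inside the existential so that `choose` yields functions of `N` and `t` alone.
  have step : ∀ (N : ℕ) (t : ℝ), ∃ (n : ℕ) (s : ℝ), 0 < t → N ≤ n ∧ 0 < s ∧ s < t ∧
      (μ n).real {x | r x ≤ δ} < c + ε ∧
      c - 2 * ε < (μ n).real {x | s ≤ r x ∧ r x ≤ t} := by
    intro N t
    by_cases ht : 0 < t
    swap
    · exact ⟨0, 0, fun h => absurd h ht⟩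
    obtain ⟨n, ⟨h1, h2⟩, hn⟩ := ((hupδ.and (hlow t ht ε hε0)).and (eventually_ge_atTop N)).exists
    -- A single measure has no mass at `r = 0`, so an inner radius can be cut off; `k + 2` keeps it
    -- strictly below `t`.
    have hlim : Tendsto (fun k : ℕ => (μ n).real {x | r x < t / (k + 2)}) atTop (𝓝 0) := by
      have hanti : Antitone fun k : ℕ => {x | r x < t / (k + 2)} := by
        intro i j hij x hx
        simp only [mem_ofPred_eq] at hx ⊢
        refine hx.trans_le ?_
        gcongr
      have hE : ⋂ k : ℕ, {x | r x < t / (k + 2)} = ∅ := by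
        ext x
        simp only [mem_iInter, mem_ofPred_eq, mem_empty_iff_false, iff_false, not_forall, not_lt]
        have : Tendsto (fun k : ℕ => t / ((k : ℝ) + 2)) atTop (𝓝 0) :=
          tendsto_const_nhds.div_atTop
            (tendsto_atTop_add_const_right _ _ tendsto_natCast_atTop_atTop)
        obtain ⟨k, hk⟩ := ((tendsto_order.1 this).2 _ (hpos x)).exists
        exact ⟨k, hk.le⟩
      have := tendsto_measure_iInter_atTop (μ := μ n)
        (fun k : ℕ => (measurableSet_lt hr.measurable
          (measurable_const (a := t / ((k : ℝ) + 2)))).nullMeasurableSet) hanti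
        ⟨0, measure_ne_top _ _⟩
      rw [hE, measure_empty] at this
      simpa [Measure.real, Function.comp_def] using
        (ENNReal.tendsto_toReal ENNReal.zero_ne_top).comp this
    obtain ⟨k, hk⟩ := ((tendsto_order.1 hlim).2 _ hε0).exists
    refine ⟨n, t / (k + 2), fun _ => ⟨hn, by positivity, ?_, h1, ?_⟩⟩
    · apply div_lt_self ht
      have : (0 : ℝ) ≤ k := k.cast_nonneg
      linarith
    · have hsub : {x | r x < t} ⊆ {x | r x < t / (k + 2)} ∪ {x | t / (k + 2) ≤ r x ∧ r x ≤ t} := by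
        intro x hx
        rcases lt_or_ge (r x) (t / (k + 2)) with h | h
        · exact Or.inl h
        · exact Or.inr ⟨h, le_of_lt hx⟩
      have := (measureReal_mono hsub).trans (measureReal_union_le (μ := μ n) _ _)
      linarith
  choose n s hstep using step
  -- The state is a lower bound for the next index and the next outer radius. Halving the inner
  -- radius separates consecutive annuli; starting at `δ / 2` keeps them all in `r < δ`.
  let st : ℕ → ℕ × ℝ := fun i => Nat.rec (0, δ / 2) (fun _ p => (n p.1 p.2 + 1, s p.1 p.2 / 2)) i
  let t : ℕ → ℝ := fun i => (st i).2
  let m : ℕ → ℕ := fun i => n (st i).1 (st i).2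
  let q : ℕ → ℝ := fun i => s (st i).1 (st i).2
  have ht_succ : ∀ i, t (i + 1) = q i / 2 := fun i => rfl
  have ht0 : ∀ i, 0 < t i := by
    intro i
    induction i with
    | zero => exact half_pos hδ
    | succ i ih => rw [ht_succ]; exact half_pos (hstep _ _ ih).2.1
  have key := fun i => hstep (st i).1 (st i).2 (ht0 i)
  have hq0 : ∀ i, 0 < q i := fun i => (key i).2.1
  have hqt : ∀ i, q i < t i := fun i => (key i).2.2.1
  have hm : StrictMono m := strictMono_nat_of_lt_succ fun i =>
    Nat.lt_of_lt_of_le (Nat.lt_succ_self _) (key (i + 1)).1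
  have ht_le : ∀ i, t i ≤ δ / 2 * (1 / 2) ^ i := by
    intro i
    induction i with
    | zero => simp [t, st]
    | succ i ih =>
      rw [ht_succ, pow_succ]
      linarith [hqt i]
  have ht_anti : StrictAnti t := strictAnti_nat_of_succ_lt fun i => by
    rw [ht_succ]; linarith [hqt i, hq0 i]
  have ht_lim : Tendsto t atTop (𝓝 0) := by
    refine squeeze_zero (fun i => (ht0 i).le) ht_le ?_
    simpa using (tendsto_pow_atTop_nhds_zero_of_lt_one (r := (1 / 2 : ℝ)) (by norm_num)
      (by norm_num)).const_mul (δ / 2)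
  let A : ℕ → Set S := fun i => {x | q i ≤ r x ∧ r x ≤ t i}
  have hAcl : ∀ i, IsClosed (A i) := fun i =>
    (isClosed_le continuous_const hr).inter (isClosed_le hr continuous_const)
  -- The annuli accumulate only at `r = 0`, which is outside `S`; therefore unions of them are
  -- closed.
  have hAfin : LocallyFinite A := by
    intro x
    refine ⟨{y | r x / 2 < r y}, (isOpen_lt continuous_const hr).mem_nhds (half_lt_self (hpos x)), ?_⟩
    obtain ⟨N, hN⟩ := eventually_atTop.1 ((tendsto_order.1 ht_lim).2 _ (half_pos (hpos x)))
    refine (finite_lt_nat N).subset fun i ⟨y, hy, hy'⟩ => ?_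
    by_contra hi
    have := hN i (not_lt.1 hi)
    simp only [A, mem_ofPred_eq] at hy hy'
    linarith
  have hAdisj : ∀ i j, i < j → Disjoint (A i) (A j) := by
    intro i j hij
    rw [Set.disjoint_left]
    rintro x ⟨h1, _⟩ ⟨_, h2⟩
    have h3 : t j ≤ t (i + 1) := ht_anti.antitone hij
    rw [ht_succ] at h3
    linarith [hq0 i]
  have hAdisj' : ∀ i j, i ≠ j → Disjoint (A i) (A j) := fun i j hij =>
    (lt_or_gt_of_ne hij).elim (hAdisj i j) fun h => (hAdisj j i h).symm
  have hAδ : ∀ i, ∀ x ∈ A i, r x < δ := by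
    rintro i x ⟨_, h⟩
    have : t i ≤ t 0 := ht_anti.antitone (Nat.zero_le i)
    have h0 : t 0 = δ / 2 := rfl
    linarith
  -- Urysohn's function is to be `1` on even annuli, and `0` on odd annuli and away from the
  -- boundary.
  let E : Set S := ⋃ i, A (2 * i)
  let O : Set S := (⋃ i, A (2 * i + 1)) ∪ {x | δ ≤ r x}
  have hEcl : IsClosed E :=
    (hAfin.comp_injective (g := fun i => 2 * i) fun a b h => by
      simpa using h).isClosed_iUnion fun i => hAcl _
  have hOcl : IsClosed O :=
    ((hAfin.comp_injective (g := fun i => 2 * i + 1) fun a b h => by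
      simpa using h).isClosed_iUnion fun i => hAcl _).union (isClosed_le continuous_const hr)
  have hEO : Disjoint O E := by
    rw [Set.disjoint_left]
    rintro x hO hE
    obtain ⟨i, hi⟩ := mem_iUnion.1 hE
    rcases hO with hO | hO
    · obtain ⟨j, hj⟩ := mem_iUnion.1 hO
      exact Set.disjoint_left.1 (hAdisj' (2 * i) (2 * j + 1) (by omega)) hi hj
    · exact absurd (hAδ _ _ hi) (not_lt.2 hO)
  obtain ⟨f, hf0, hf1, hf01⟩ := exists_bounded_zero_one_of_closed hOcl hEcl hEO
  refine ⟨f, fun l hl => ?_⟩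
  have hAm : ∀ i, MeasurableSet (A i) := fun i => (hAcl i).measurableSet
  have heven : ∀ i, c - 2 * ε ≤ ∫ x, f x ∂μ (m (2 * i)) := by
    intro i
    have h1 : ∫ x, (A (2 * i)).indicator (fun _ => (1 : ℝ)) x ∂μ (m (2 * i)) ≤
        ∫ x, f x ∂μ (m (2 * i)) := by
      refine integral_mono ((integrable_const _).indicator (hAm _)) (f.integrable _) fun x => ?_
      by_cases hx : x ∈ A (2 * i)
      · simp only [indicator_of_mem hx]
        exact (hf1 (mem_iUnion.2 ⟨i, hx⟩)).ge
      · simp only [indicator_of_notMem hx]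
        exact (hf01 x).1
    rw [integral_indicator_const _ (hAm _), smul_eq_mul, mul_one] at h1
    exact (key (2 * i)).2.2.2.2.le.trans h1
  -- Here `f` lives on `r ≤ δ` minus the odd annulus, of mass below `(c + ε) - (c - 2 * ε)`.
  have hodd : ∀ i, ∫ x, f x ∂μ (m (2 * i + 1)) ≤ 3 * ε := by
    intro i
    have hD : MeasurableSet {x | r x ≤ δ} := measurableSet_le hr.measurable measurable_const
    have h1 : ∫ x, f x ∂μ (m (2 * i + 1)) ≤
        ∫ x, ({x | r x ≤ δ} \ A (2 * i + 1)).indicator (fun _ => (1 : ℝ)) x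
          ∂μ (m (2 * i + 1)) := by
      refine integral_mono (f.integrable _)
        ((integrable_const _).indicator (hD.diff (hAm (2 * i + 1)))) fun x => ?_
      by_cases hx : x ∈ {x | r x ≤ δ} \ A (2 * i + 1)
      · simp only [indicator_of_mem hx]
        exact (hf01 x).2
      · simp only [indicator_of_notMem hx]
        refine (hf0 ?_).le
        rcases le_or_gt (r x) δ with h | h
        · by_cases hA : x ∈ A (2 * i + 1)
          · exact Or.inl (mem_iUnion.2 ⟨i, hA⟩)
          · exact absurd ⟨h, hA⟩ hx
        · exact Or.inr h.le
    rw [integral_indicator_const _ (hD.diff (hAm (2 * i + 1))), smul_eq_mul, mul_one,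
      measureReal_sdiff (show A (2 * i + 1) ⊆ {x | r x ≤ δ} from fun x hx => (hAδ (2 * i + 1) x hx).le)
        (hAm (2 * i + 1))] at h1
    have h2 := (key (2 * i + 1)).2.2.2
    have h3 : (μ (m (2 * i + 1))).real {x | r x ≤ δ} < c + ε := h2.1
    have h4 : c - 2 * ε < (μ (m (2 * i + 1))).real (A (2 * i + 1)) := h2.2
    linarith
  have l1 : c - 2 * ε ≤ l := ge_of_tendsto' (hl.comp (hm.comp
    (strictMono_mul_left_of_pos two_pos)).tendsto_atTop) heven
  have l2 : l ≤ 3 * ε := le_of_tendsto' (hl.comp (hm.comp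
    ((strictMono_mul_left_of_pos two_pos).add_const 1)).tendsto_atTop) hodd
  linarith

/-! ### Bounded convergence in measure -/

lemma ae_abs_le_of_tendstoInMeasure {Ω : Type*} [MeasurableSpace Ω] {P : Measure Ω}
    {U : ℕ → Ω → ℝ} {V : Ω → ℝ} {C : ℝ} (hUC : ∀ n ω, |U n ω| ≤ C)
    (h : TendstoInMeasure P U atTop V) : ∀ᵐ ω ∂P, |V ω| ≤ C := by
  obtain ⟨ms, -, hms⟩ := h.exists_seq_tendsto_ae
  filter_upwards [hms] with ω hω
  exact le_of_tendsto' hω.abs fun n => hUC _ ω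

/-- Uniformly bounded convergence in measure on a finite measure space gives `L¹` convergence. -/
lemma tendsto_integral_abs_sub_of_tendstoInMeasure {Ω : Type*} [MeasurableSpace Ω] {P : Measure Ω}
    [IsFiniteMeasure P] {U : ℕ → Ω → ℝ} {V : Ω → ℝ} {C : ℝ} (hU : ∀ n, AEStronglyMeasurable (U n) P)
    (hUC : ∀ n ω, |U n ω| ≤ C) (h : TendstoInMeasure P U atTop V) :
    Tendsto (fun n => ∫ ω, |U n ω - V ω| ∂P) atTop (𝓝 0) := by
  have hV := h.aestronglyMeasurable hU
  refine tendsto_of_subseq_tendsto fun ns hns => ?_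
  obtain ⟨ms, -, hms⟩ := (h.comp hns).exists_seq_tendsto_ae
  refine ⟨ms, ?_⟩
  have : Tendsto (fun n => ∫ ω, |U (ns (ms n)) ω - V ω| ∂P) atTop (𝓝 (∫ _, (0 : ℝ) ∂P)) := by
    refine tendsto_integral_of_dominated_convergence (fun _ => 2 * C)
      (fun n => ((hU _).sub hV).norm) (integrable_const _) (fun n => ?_) ?_
    · filter_upwards [ae_abs_le_of_tendstoInMeasure hUC h] with ω hω
      rw [Real.norm_eq_abs, abs_abs]
      have := abs_sub (U (ns (ms n)) ω) (V ω)
      linarith [hUC (ns (ms n)) ω]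
    · filter_upwards [hms] with ω hω
      have := (hω.sub_const (V ω)).abs
      simpa using this
  simpa using this

lemma tendsto_integral_of_tendstoInMeasure {Ω : Type*} [MeasurableSpace Ω] {P : Measure Ω}
    [IsFiniteMeasure P] {U : ℕ → Ω → ℝ} {V : Ω → ℝ} {C : ℝ} (hU : ∀ n, AEStronglyMeasurable (U n) P)
    (hUC : ∀ n ω, |U n ω| ≤ C) (h : TendstoInMeasure P U atTop V) :
    Tendsto (fun n => ∫ ω, U n ω ∂P) atTop (𝓝 (∫ ω, V ω ∂P)) := by
  have hVi : Integrable V P := Integrable.of_bound (h.aestronglyMeasurable hU) C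
    (ae_abs_le_of_tendstoInMeasure hUC h)
  have hUi : ∀ n, Integrable (U n) P := fun n =>
    Integrable.of_bound (hU n) C (Eventually.of_forall (hUC n))
  rw [tendsto_iff_dist_tendsto_zero]
  refine squeeze_zero (fun n => dist_nonneg) (fun n => ?_)
    (tendsto_integral_abs_sub_of_tendstoInMeasure hU hUC h)
  rw [dist_eq_norm, ← integral_sub (hUi n) hVi]
  exact norm_integral_le_integral_norm _

/-- Countably many sequences that converge in measure converge almost everywhere along a common
subsequence. -/
lemma exists_common_seq_tendsto_ae {Ω : Type*} [MeasurableSpace Ω] {P : Measure Ω}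
    {U : ℕ → ℕ → Ω → ℝ} {g : ℕ → Ω → ℝ} (h : ∀ k, TendstoInMeasure P (U k) atTop (g k)) :
    ∃ ns : ℕ → ℕ, StrictMono ns ∧
      ∀ᵐ ω ∂P, ∀ k, Tendsto (fun j => U k (ns j) ω) atTop (𝓝 (g k ω)) := by
  -- Stage `j` controls the first `j + 1` sequences at once with summable error, so Borel–Cantelli
  -- applies to each of them.
  have hev : ∀ j : ℕ, ∀ᶠ n in atTop, ∀ k ∈ Finset.range (j + 1),
      P {ω | (2⁻¹ : ENNReal) ^ j ≤ edist (U k n ω) (g k ω)} ≤ (2⁻¹ : ENNReal) ^ j := by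
    intro j
    rw [Filter.eventually_all_finset]
    intro k _
    have hpos : (0 : ENNReal) < 2⁻¹ ^ j := ENNReal.pow_pos (by simp) _
    exact (tendsto_order.1 (h k _ hpos)).2 _ hpos |>.mono fun n hn => hn.le
  obtain ⟨ns, hns, hP⟩ := extraction_forall_of_eventually hev
  refine ⟨ns, hns, ae_all_iff.2 fun k => ?_⟩
  let s : ℕ → Set Ω := fun j =>
    if k ≤ j then {ω | (2⁻¹ : ENNReal) ^ j ≤ edist (U k (ns j) ω) (g k ω)} else ∅
  have hs : ∑' j, P (s j) ≠ ⊤ := by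
    refine ne_top_of_le_ne_top (b := ∑' j : ℕ, (2⁻¹ : ENNReal) ^ j) ?_
      (ENNReal.tsum_le_tsum fun j => ?_)
    · rw [ENNReal.tsum_geometric]
      simp
    · by_cases hkj : k ≤ j
      · simp only [s, hkj, if_true]
        exact hP j k (Finset.mem_range.2 (by omega))
      · simp [s, hkj]
  filter_upwards [ae_eventually_notMem hs] with ω hω
  rw [tendsto_iff_edist_tendsto_0]
  have hlim : Tendsto (fun j : ℕ => (2⁻¹ : ENNReal) ^ j) atTop (𝓝 0) :=
    ENNReal.tendsto_pow_atTop_nhds_zero_of_lt_one (by simp)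
  refine tendsto_of_tendsto_of_tendsto_of_le_of_le' tendsto_const_nhds hlim
    (Eventually.of_forall fun _ => zero_le) ?_
  filter_upwards [hω, eventually_ge_atTop k] with j hj hkj
  simp only [s, hkj, if_true, mem_ofPred_eq, not_le] at hj
  exact hj.le

lemma abs_integral_bcf_le {S : Type*} [MeasurableSpace S] [TopologicalSpace S]
    [OpensMeasurableSpace S] (μ : Measure S) [IsProbabilityMeasure μ] (f : S →ᵇ ℝ) :
    |∫ x, f x ∂μ| ≤ ‖f‖ := by
  simpa using f.norm_integral_le_norm μ

/-! ### Predictive distributions as conditional laws -/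

section Predictive

variable {Ω : Type v} {S : Type u} [MeasurableSpace S]

/-- The `σ`-field generated by the first `n` terms of a sequence. -/
abbrev pastField (X : ℕ → Ω → S) (n : ℕ) : MeasurableSpace Ω :=
  MeasurableSpace.comap (fun (ω : Ω) (i : Fin n) => X i ω) inferInstance

lemma measurable_pastField (X : ℕ → Ω → S) {i n : ℕ} (h : i < n) :
    Measurable[pastField X n] (X i) := by
  have : X i = (fun x : Fin n → S => x ⟨i, h⟩) ∘ fun ω (j : Fin n) => X j ω := rfl
  rw [this]
  exact (measurable_pi_apply _).comp (comap_measurable _)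

lemma pastField_mono (X : ℕ → Ω → S) {m n : ℕ} (h : m ≤ n) : pastField X m ≤ pastField X n := by
  rw [← measurable_iff_comap_le]
  exact @measurable_pi_lambda _ _ _ (pastField X n) _ _ fun i => measurable_pastField X (i.2.trans_le h)

variable [MeasurableSpace Ω]

lemma pastField_le {X : ℕ → Ω → S} (hX : ∀ n, Measurable (X n)) (n : ℕ) :
    pastField X n ≤ ‹MeasurableSpace Ω› :=
  (measurable_pi_lambda _ fun i : Fin n => hX i).comap_le

variable [StandardBorelSpace S] [Nonempty S] (P : Measure Ω) [IsFiniteMeasure P]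

instance (X : ℕ → Ω → S) (n : ℕ) (ω : Ω) : IsProbabilityMeasure (predictive P X n ω) := by
  unfold predictive; infer_instance

lemma measurable_predictive {X : ℕ → Ω → S} (hX : ∀ n, Measurable (X n)) (n : ℕ) :
    Measurable (predictive P X n) :=
  (condDistrib _ _ P).measurable.comp (measurable_pi_lambda _ fun i : Fin n => hX i)

variable [TopologicalSpace S] [OpensMeasurableSpace S]

lemma stronglyMeasurable_integral_predictive (X : ℕ → Ω → S) (n : ℕ) (f : S →ᵇ ℝ) :
    StronglyMeasurable[pastField X n] fun ω => ∫ x, f x ∂predictive P X n ω :=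
  stronglyMeasurable_integral_condDistrib (f := fun p : (Fin n → S) × S => f p.2)
    (f.continuous.measurable.stronglyMeasurable.comp_measurable measurable_snd)

/-- The defining property of the predictive distributions. -/
lemma integral_mul_eq_integral_mul_predictive {X : ℕ → Ω → S} (hX : ∀ n, Measurable (X n)) (n : ℕ)
    (f : S →ᵇ ℝ) {Y : Ω → ℝ} {C : ℝ} (hY : StronglyMeasurable[pastField X n] Y)
    (hYC : ∀ ω, |Y ω| ≤ C) :
    ∫ ω, Y ω * f (X n ω) ∂P = ∫ ω, Y ω * ∫ x, f x ∂predictive P X n ω ∂P := by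
  have hfm : StronglyMeasurable f := f.continuous.measurable.stronglyMeasurable
  have hfX : Integrable (fun ω => f (X n ω)) P :=
    Integrable.of_bound (hfm.comp_measurable (hX n)).aestronglyMeasurable ‖f‖
      (Eventually.of_forall fun ω => f.norm_coe_le_norm _)
  have hYf : Integrable (fun ω => Y ω * f (X n ω)) P :=
    hfX.bdd_mul (hY.mono (pastField_le hX n)).aestronglyMeasurable (Eventually.of_forall hYC)
  have h1 : P[fun ω => f (X n ω) | pastField X n] =ᵐ[P]
      fun ω => ∫ x, f x ∂predictive P X n ω :=
    condExp_ae_eq_integral_condDistrib (measurable_pi_lambda _ fun i : Fin n => hX i)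
      (hX n).aemeasurable hfm hfX
  have h2 := condExp_mul_of_stronglyMeasurable_left hY hYf hfX
  rw [← integral_condExp (pastField_le hX n)]
  refine integral_congr_ae ?_
  filter_upwards [h1, h2] with ω h1 h2
  rw [← h1]
  exact h2

end Predictive

/-! ### Moments of the shifted sequence -/

section ProductMoments

variable {Ω : Type v} [MeasurableSpace Ω] {S : Type u} [MeasurableSpace S]
  [TopologicalSpace S] [OpensMeasurableSpace S]

lemma measurable_integral_kernel (α : Kernel Ω S) [IsMarkovKernel α] (f : S →ᵇ ℝ) :
    Measurable fun ω => ∫ x, f x ∂α ω :=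
  (StronglyMeasurable.integral_kernel f.continuous.measurable.stronglyMeasurable).measurable

/-- Replacing a uniformly `L¹`-small factor does not change limits of expectations of bounded
products. -/
lemma tendsto_integral_mul_sub_zero {P : Measure Ω} [IsProbabilityMeasure P] {Y U V : ℕ → Ω → ℝ}
    {C : ℝ} (hYC : ∀ n ω, |Y n ω| ≤ C) (hU : ∀ n, Integrable (U n) P)
    (hV : ∀ n, Integrable (V n) P)
    (h : Tendsto (fun n => ∫ ω, |U n ω - V n ω| ∂P) atTop (𝓝 0)) :
    Tendsto (fun n => ∫ ω, Y n ω * (U n ω - V n ω) ∂P) atTop (𝓝 0) := by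
  refine squeeze_zero_norm (a := fun n => C * ∫ ω, |U n ω - V n ω| ∂P) (fun n => ?_)
    (by simpa using h.const_mul C)
  rw [← integral_const_mul]
  refine norm_integral_le_of_norm_le (((hU n).sub (hV n)).abs.const_mul C)
    (Eventually.of_forall fun ω => ?_)
  rw [norm_mul]
  exact mul_le_mul_of_nonneg_right (hYC n ω) (norm_nonneg _)

lemma abs_prod_bcf_le {S : Type*} [TopologicalSpace S] {k : ℕ} (f : Fin k → S →ᵇ ℝ)
    (x : Fin k → S) : |∏ j, f j (x j)| ≤ ∏ j, ‖f j‖ := by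
  rw [Finset.abs_prod]
  exact Finset.prod_le_prod (fun _ _ => abs_nonneg _) fun j _ => (f j).norm_coe_le_norm _

variable [StandardBorelSpace S] [Nonempty S] {P : Measure Ω} [IsProbabilityMeasure P]

lemma IsPredictiveLimit.tendsto_integral_abs_sub {X : ℕ → Ω → S} (hX : ∀ n, Measurable (X n))
    {α : Kernel Ω S} [IsMarkovKernel α] (hα : IsPredictiveLimit P X α) (f : S →ᵇ ℝ) :
    Tendsto (fun n => ∫ ω, |∫ x, f x ∂predictive P X n ω - ∫ x, f x ∂α ω| ∂P) atTop (𝓝 0) :=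
  tendsto_integral_abs_sub_of_tendstoInMeasure (C := ‖f‖)
    (fun n => ((stronglyMeasurable_integral_predictive P X n f).mono
      (pastField_le hX n)).aestronglyMeasurable)
    (fun _ _ => abs_integral_bcf_le _ f) (hα f)

/-- The joint moments of the shifted sequence converge to the moments of the mixture directed by
the limit of the predictive distributions. -/
lemma IsPredictiveLimit.tendsto_integral_mul_prod {X : ℕ → Ω → S} (hX : ∀ n, Measurable (X n))
    {α : Kernel Ω S} [IsMarkovKernel α] (hα : IsPredictiveLimit P X α) (k : ℕ) :
    ∀ (f : Fin k → S →ᵇ ℝ) {V : ℕ → Ω → ℝ} {W : Ω → ℝ} {C : ℝ},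
      (∀ n, StronglyMeasurable[pastField X n] (V n)) → Measurable W →
      (∀ n ω, |V n ω| ≤ C) → (∀ ω, |W ω| ≤ C) →
      Tendsto (fun n => ∫ ω, |V n ω - W ω| ∂P) atTop (𝓝 0) →
      Tendsto (fun n => ∫ ω, V n ω * ∏ j, f j (X (n + j) ω) ∂P) atTop
        (𝓝 (∫ ω, W ω * ∏ j, ∫ x, f j x ∂α ω ∂P)) := by
  -- The weights `V n` make the induction close: the predictive integral replacing the last factor
  -- is absorbed into them.
  induction k with
  | zero =>
    intro f V W C hV hW hVC hWC h
    have hVi : ∀ n, Integrable (V n) P := fun n =>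
      Integrable.of_bound ((hV n).mono (pastField_le hX n)).aestronglyMeasurable C
        (Eventually.of_forall (hVC n))
    have hWi : Integrable W P :=
      Integrable.of_bound hW.aestronglyMeasurable C (Eventually.of_forall hWC)
    have := tendsto_integral_mul_sub_zero (P := P) (Y := fun _ _ => 1) (C := 1) (by simp) hVi
      (fun _ => hWi) h
    simp only [one_mul] at this
    have h2 := this.add_const (∫ ω, W ω ∂P)
    simp only [zero_add] at h2
    simp only [Finset.univ_eq_empty, Finset.prod_empty, mul_one]
    refine h2.congr fun n => ?_
    rw [integral_sub (hVi n) hWi, sub_add_cancel]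
  | succ k ih =>
    intro f V W C hV hW hVC hWC h
    set g := f (Fin.last k)
    let a : ℕ → Ω → ℝ := fun n ω => ∫ x, g x ∂predictive P X n ω
    let b : Ω → ℝ := fun ω => ∫ x, g x ∂α ω
    have ham : ∀ n, StronglyMeasurable[pastField X n] (a n) := fun n =>
      stronglyMeasurable_integral_predictive P X n g
    have hbm : Measurable b := measurable_integral_kernel α g
    have haC : ∀ n ω, |a n ω| ≤ ‖g‖ := fun n ω => abs_integral_bcf_le _ g
    have hbC : ∀ ω, |b ω| ≤ ‖g‖ := fun ω => abs_integral_bcf_le _ g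
    have hai : ∀ n, Integrable (a n) P := fun n =>
      Integrable.of_bound ((ham n).mono (pastField_le hX n)).aestronglyMeasurable ‖g‖
        (Eventually.of_forall (haC n))
    have hbi : Integrable b P :=
      Integrable.of_bound hbm.aestronglyMeasurable ‖g‖ (Eventually.of_forall hbC)
    have hVi : ∀ n, Integrable (V n) P := fun n =>
      Integrable.of_bound ((hV n).mono (pastField_le hX n)).aestronglyMeasurable C
        (Eventually.of_forall (hVC n))
    have hWi : Integrable W P :=
      Integrable.of_bound hW.aestronglyMeasurable C (Eventually.of_forall hWC)
    obtain ⟨ω₀⟩ : Nonempty Ω := nonempty_of_isProbabilityMeasure P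
    have hC : 0 ≤ C := (abs_nonneg _).trans (hWC ω₀)
    have hVWi : ∀ n, Integrable (fun ω => |V n ω - W ω|) P := fun n => ((hVi n).sub hWi).abs
    have habi : ∀ n, Integrable (fun ω => |a n ω - b ω|) P := fun n => ((hai n).sub hbi).abs
    have hab : Tendsto (fun n => ∫ ω, |a n ω - b ω| ∂P) atTop (𝓝 0) :=
      hα.tendsto_integral_abs_sub hX g
    have hVa : Tendsto (fun n => ∫ ω, |V n ω * a n ω - W ω * b ω| ∂P) atTop (𝓝 0) := by
      have h0 : Tendsto (fun n => ‖g‖ * ∫ ω, |V n ω - W ω| ∂P + C * ∫ ω, |a n ω - b ω| ∂P) atTop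
          (𝓝 0) := by simpa using (h.const_mul ‖g‖).add (hab.const_mul C)
      refine squeeze_zero (fun n => integral_nonneg fun ω => abs_nonneg _) (fun n => ?_) h0
      rw [← integral_const_mul, ← integral_const_mul, ← integral_add
        ((hVWi n).const_mul _) ((habi n).const_mul _)]
      refine integral_mono_of_nonneg (Eventually.of_forall fun ω => abs_nonneg _)
        (((hVWi n).const_mul _).add ((habi n).const_mul _))
        (Eventually.of_forall fun ω => ?_)
      have e : V n ω * a n ω - W ω * b ω = a n ω * (V n ω - W ω) + W ω * (a n ω - b ω) := by ring
      simp only [e]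
      refine (abs_add_le _ _).trans ?_
      rw [abs_mul, abs_mul]
      exact add_le_add (mul_le_mul_of_nonneg_right (haC n ω) (abs_nonneg _))
        (mul_le_mul_of_nonneg_right (hWC ω) (abs_nonneg _))
    have ih' := ih (fun j => f j.castSucc) (V := fun n ω => V n ω * a n ω)
      (W := fun ω => W ω * b ω) (C := C * ‖g‖) (fun n => (hV n).mul (ham n)) (hW.mul hbm)
      (fun n ω => by
        rw [abs_mul]; exact mul_le_mul (hVC n ω) (haC n ω) (abs_nonneg _) hC)
      (fun ω => by
        rw [abs_mul]; exact mul_le_mul (hWC ω) (hbC ω) (abs_nonneg _) hC) hVa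
    -- All but the last factor is known at time `n + k`, so conditioning at that time affects only
    -- `g (X (n + k))`.
    let Y : ℕ → Ω → ℝ := fun n ω => V n ω * ∏ j : Fin k, f j.castSucc (X (n + j) ω)
    have hYm : ∀ n, StronglyMeasurable[pastField X (n + k)] (Y n) := fun n =>
      ((hV n).mono (pastField_mono X (Nat.le_add_right n k))).mul
        (Finset.stronglyMeasurable_fun_prod _ fun j _ =>
          (f j.castSucc).continuous.measurable.stronglyMeasurable.comp_measurable
            (measurable_pastField X (by omega)))
    have hYC : ∀ n ω, |Y n ω| ≤ C * ∏ j : Fin k, ‖f j.castSucc‖ := fun n ω => by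
      rw [abs_mul]
      exact mul_le_mul (hVC n ω) (abs_prod_bcf_le _ _) (abs_nonneg _) hC
    have hYs : ∀ n, AEStronglyMeasurable (Y n) P := fun n =>
      ((hYm n).mono (pastField_le hX _)).aestronglyMeasurable
    -- Both terms have the `L¹` limit `b`; this moves the predictive back to time `n`.
    have hshift : Tendsto (fun n => ∫ ω, |a (n + k) ω - a n ω| ∂P) atTop (𝓝 0) := by
      have h0 := (hab.comp (tendsto_add_atTop_nat k)).add hab
      rw [add_zero] at h0
      refine squeeze_zero (fun n => integral_nonneg fun ω => abs_nonneg _) (fun n => ?_) h0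
      simp only [Function.comp_apply]
      rw [← integral_add (habi (n + k)) (habi n)]
      refine integral_mono_of_nonneg (Eventually.of_forall fun ω => abs_nonneg _)
        ((habi (n + k)).add (habi n)) (Eventually.of_forall fun ω => ?_)
      have := abs_sub_le (a (n + k) ω) (b ω) (a n ω)
      rw [abs_sub_comm (b ω)] at this
      exact this
    have h1 := (tendsto_integral_mul_sub_zero hYC (fun n => hai (n + k)) hai hshift).add ih'
    rw [zero_add] at h1
    have elim : ∫ ω, W ω * ∏ j, ∫ x, f j x ∂α ω ∂P =
        ∫ ω, W ω * b ω * ∏ j : Fin k, ∫ x, f j.castSucc x ∂α ω ∂P := by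
      refine integral_congr_ae (Eventually.of_forall fun ω => ?_)
      simp only [Fin.prod_univ_castSucc]
      ring
    rw [elim]
    refine h1.congr fun n => ?_
    have hYa : ∀ m, Integrable (fun ω => Y n ω * a m ω) P := fun m =>
      (hai m).bdd_mul (hYs n) (Eventually.of_forall (hYC n))
    have e1 : ∫ ω, V n ω * a n ω * ∏ j : Fin k, f j.castSucc (X (n + j) ω) ∂P =
        ∫ ω, Y n ω * a n ω ∂P := by
      refine integral_congr_ae (Eventually.of_forall fun ω => ?_)
      simp only [Y]
      ring
    have e2 : ∫ ω, V n ω * ∏ j, f j (X (n + j) ω) ∂P = ∫ ω, Y n ω * g (X (n + k) ω) ∂P := by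
      refine integral_congr_ae (Eventually.of_forall fun ω => ?_)
      simp only [Y, Fin.prod_univ_castSucc, Fin.val_castSucc, Fin.val_last]
      ring
    rw [e1, e2, integral_mul_eq_integral_mul_predictive P hX (n + k) g (hYm n) (hYC n)]
    simp only [mul_sub]
    rw [integral_sub (hYa _) (hYa _), sub_add_cancel]

lemma IsPredictiveLimit.tendsto_integral_prod {X : ℕ → Ω → S} (hX : ∀ n, Measurable (X n))
    {α : Kernel Ω S} [IsMarkovKernel α] (hα : IsPredictiveLimit P X α) {k : ℕ}
    (f : Fin k → S →ᵇ ℝ) :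
    Tendsto (fun n => ∫ ω, ∏ j, f j (X (n + j) ω) ∂P) atTop
      (𝓝 (∫ ω, ∏ j, ∫ x, f j x ∂α ω ∂P)) := by
  simpa using hα.tendsto_integral_mul_prod hX k f (V := fun _ _ => 1) (W := fun _ => 1) (C := 1)
    (fun _ => stronglyMeasurable_const) measurable_const (by simp) (by simp) (by simp)

end ProductMoments

/-! ### Mixtures of i.i.d. laws -/

lemma integral_bind_kernel {Ω T : Type*} [MeasurableSpace Ω] [MeasurableSpace T] {P : Measure Ω}
    [IsFiniteMeasure P] {κ : Kernel Ω T} [IsFiniteKernel κ] {f : T → ℝ}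
    (hf : Integrable f (P.bind κ)) :
    ∫ z, f z ∂(P.bind κ) = ∫ ω, ∫ z, f z ∂κ ω ∂P := by
  rw [Measure.comp_eq_comp_const_apply] at hf ⊢
  rw [Kernel.integral_comp hf, Kernel.const_apply]

section Mixture

variable {Ω : Type v} [MeasurableSpace Ω] {S : Type u} [MeasurableSpace S]

/-- The kernel `ω ↦ α(ω)^ℕ` of i.i.d. sequence laws directed by a Markov kernel. -/
noncomputable def iidKernel (α : Kernel Ω S) [IsMarkovKernel α] : Kernel Ω (ℕ → S) where
  toFun ω := Measure.infinitePi fun _ : ℕ => α ω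
  measurable' := by
    refine Measurable.measure_of_isPiSystem_of_isProbabilityMeasure
      (S := squareCylinders fun _ : ℕ => {s : Set S | MeasurableSet s})
      (generateFrom_squareCylinders (α := fun _ : ℕ => S)).symm
      (isPiSystem_squareCylinders (fun _ => MeasurableSpace.isPiSystem_measurableSet)
        fun _ => MeasurableSet.univ) ?_
    rintro _ ⟨s, t, ht, rfl⟩
    have : ∀ ω, Measure.infinitePi (fun _ : ℕ => α ω) (Set.pi s t) = ∏ i ∈ s, α ω (t i) := fun ω =>
      Measure.infinitePi_pi _ fun i _ => ht i (mem_univ i)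
    simp_rw [this]
    exact Finset.measurable_fun_prod _ fun i _ => Kernel.measurable_coe α (ht i (mem_univ i))

instance (α : Kernel Ω S) [IsMarkovKernel α] : IsMarkovKernel (iidKernel α) :=
  ⟨fun ω => inferInstanceAs (IsProbabilityMeasure (Measure.infinitePi fun _ : ℕ => α ω))⟩

lemma iidKernel_map_fin (α : Kernel Ω S) [IsMarkovKernel α] (k : ℕ) (ω : Ω) :
    (iidKernel α ω).map (fun z (i : Fin k) => z i) = Measure.pi fun _ : Fin k => α ω := by
  refine (Measure.pi_eq fun B hB => ?_).symm
  have hm : Measurable (fun (z : ℕ → S) (i : Fin k) => z i) :=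
    measurable_pi_lambda _ fun i => measurable_pi_apply _
  rw [Measure.map_apply hm (MeasurableSet.univ_pi hB)]
  -- Padding by `univ` turns the finite rectangle into a cylinder.
  let t : ℕ → Set S := fun i => if h : i < k then B ⟨i, h⟩ else univ
  have ht : ∀ i : Fin k, t i = B i := fun i => by simp [t]
  have e : (fun (z : ℕ → S) (i : Fin k) => z i) ⁻¹' univ.pi B =
      Set.pi (Finset.range k : Set ℕ) t := by
    ext z
    simp only [mem_preimage, Set.mem_pi, mem_univ, true_implies, Finset.coe_range, mem_Iio]
    constructor
    · intro h i hi
      have := h ⟨i, hi⟩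
      rwa [← ht] at this
    · intro h i
      rw [← ht]
      exact h i i.2
  rw [e]
  refine (Measure.infinitePi_pi (fun _ : ℕ => α ω) fun i hi => ?_).trans ?_
  · have := ht ⟨i, Finset.mem_range.1 hi⟩
    rw [show t i = _ from this]
    exact hB _
  · rw [Finset.prod_range]
    exact Finset.prod_congr rfl fun i _ => by rw [ht]

lemma isIIDMixture_bind_iidKernel (P : Measure Ω) (α : Kernel Ω S) [IsMarkovKernel α] :
    IsIIDMixture P α (P.bind (iidKernel α)) (fun i (z : ℕ → S) => z i) := by
  intro k B hB
  have hm : Measurable (fun (z : ℕ → S) (i : Fin k) => z i) :=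
    measurable_pi_lambda _ fun i => measurable_pi_apply _
  have e : {z : ℕ → S | ∀ i : Fin k, z i ∈ B i} = (fun z (i : Fin k) => z i) ⁻¹' univ.pi B := by
    ext z; simp
  rw [e, Measure.bind_apply (hm (MeasurableSet.univ_pi hB)) (iidKernel α).aemeasurable]
  refine lintegral_congr fun ω => ?_
  rw [← Measure.map_apply hm (MeasurableSet.univ_pi hB), iidKernel_map_fin, Measure.pi_pi]

/-- Rectangles determine the finite-dimensional laws, and the product under the expectation is
insensitive to permuting its factors. -/
lemma IsIIDMixture.exchangeable {Ω' : Type u} [MeasurableSpace Ω'] {P : Measure Ω}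
    {α : Kernel Ω S} {Q : Measure Ω'} [IsProbabilityMeasure Q] {Z : ℕ → Ω' → S}
    (hZ : ∀ i, Measurable (Z i)) (h : IsIIDMixture P α Q Z) : Exchangeable Q Z := by
  intro n σ
  have h1 : Measurable fun (ω : Ω') (i : Fin n) => Z (σ i) ω := measurable_pi_lambda _ fun i => hZ _
  have h2 : Measurable fun (ω : Ω') (i : Fin n) => Z i ω := measurable_pi_lambda _ fun i => hZ _
  refine ⟨h1.aemeasurable, h2.aemeasurable, ?_⟩
  refine ext_of_generate_finite _ (generateFrom_pi (α := fun _ : Fin n => S)).symm isPiSystem_pi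
    ?_ ?_
  · rintro _ ⟨B, hB, rfl⟩
    have hB' : ∀ i, MeasurableSet (B i) := fun i => hB i (mem_univ i)
    rw [Measure.map_apply h1 (MeasurableSet.univ_pi hB'),
      Measure.map_apply h2 (MeasurableSet.univ_pi hB')]
    have e1 : (fun (ω : Ω') (i : Fin n) => Z (σ i) ω) ⁻¹' univ.pi B =
        {ω | ∀ i : Fin n, Z i ω ∈ B (σ.symm i)} := by
      ext ω
      simp only [mem_preimage, Set.mem_pi, mem_univ, true_implies, mem_ofPred_eq]
      exact ⟨fun h i => by simpa using h (σ.symm i), fun h i => by simpa using h (σ i)⟩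
    have e2 : (fun (ω : Ω') (i : Fin n) => Z i ω) ⁻¹' univ.pi B =
        {ω | ∀ i : Fin n, Z i ω ∈ B i} := by
      ext ω; simp
    rw [e1, e2, h n _ fun i => hB' _, h n _ hB']
    exact lintegral_congr fun ω => Equiv.prod_comp σ.symm fun i => α ω (B i)
  · rw [Measure.map_apply h1 MeasurableSet.univ, Measure.map_apply h2 MeasurableSet.univ]
    simp

/-- Given `ω` the coordinates are independent. The value matches the limit in
`IsPredictiveLimit.tendsto_integral_prod`. -/
lemma integral_prod_bind_iidKernel [TopologicalSpace S] [OpensMeasurableSpace S] (P : Measure Ω)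
    [IsProbabilityMeasure P] (α : Kernel Ω S) [IsMarkovKernel α] {k : ℕ} (f : Fin k → S →ᵇ ℝ) :
    ∫ z, ∏ j, f j (z j) ∂(P.bind (iidKernel α)) = ∫ ω, ∏ j, ∫ x, f j x ∂α ω ∂P := by
  have hm : Measurable (fun (z : ℕ → S) (i : Fin k) => z i) :=
    measurable_pi_lambda _ fun i => measurable_pi_apply _
  have hf : Measurable fun z : Fin k → S => ∏ j, f j (z j) :=
    Finset.measurable_fun_prod _ fun j _ =>
      (f j).continuous.measurable.comp (measurable_pi_apply j)
  have hint : Integrable (fun z : ℕ → S => ∏ j, f j (z j)) (P.bind (iidKernel α)) :=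
    Integrable.of_bound (hf.comp hm).aestronglyMeasurable (∏ j, ‖f j‖)
      (Eventually.of_forall fun z => abs_prod_bcf_le f fun j => z j)
  rw [integral_bind_kernel hint]
  refine integral_congr_ae (Eventually.of_forall fun ω => ?_)
  have := integral_map (μ := iidKernel α ω) hm.aemeasurable hf.aestronglyMeasurable
  simp only at this ⊢
  rw [← this, iidKernel_map_fin, integral_fintype_prod_eq_prod (fun j x => f j x)]

end Mixture

/-! ### Weak convergence on compact spaces and countable powers -/

lemma integrable_continuousMap {K : Type*} [TopologicalSpace K] [CompactSpace K]
    [MeasurableSpace K] [OpensMeasurableSpace K] (μ : Measure K) [IsFiniteMeasure μ] (f : C(K, ℝ)) :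
    Integrable f μ :=
  (BoundedContinuousFunction.mkOfCompact f).integrable μ

/-- On a compact space, weak convergence of probability measures can be tested on a dense set of
continuous functions. -/
lemma tendsto_probabilityMeasure_of_dense {γ K : Type*} {l : Filter γ} [TopologicalSpace K]
    [CompactSpace K] [MeasurableSpace K] [OpensMeasurableSpace K] {μs : γ → ProbabilityMeasure K}
    {μ : ProbabilityMeasure K} {D : Set C(K, ℝ)} (hD : Dense D)
    (h : ∀ f ∈ D, Tendsto (fun i => ∫ x, f x ∂(μs i : Measure K)) l
      (𝓝 (∫ x, f x ∂(μ : Measure K)))) :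
    Tendsto μs l (𝓝 μ) := by
  rw [ProbabilityMeasure.tendsto_iff_forall_integral_tendsto]
  intro f
  rw [Metric.tendsto_nhds]
  intro ε hε
  obtain ⟨g, hgD, hg⟩ := Metric.dense_iff.1 hD f.toContinuousMap (ε / 3) (by positivity)
  rw [Metric.mem_ball', ] at hgD
  have key : ∀ ν : ProbabilityMeasure K,
      |∫ x, f x ∂(ν : Measure K) - ∫ x, g x ∂(ν : Measure K)| ≤ ε / 3 := by
    intro ν
    rw [← integral_sub (f.integrable _) (integrable_continuousMap _ g)]
    have hle : ∀ x, ‖f x - g x‖ ≤ ε / 3 := fun x => ?_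
    · simpa using norm_integral_le_of_norm_le_const (μ := (ν : Measure K)) (Eventually.of_forall hle)
    rw [← dist_eq_norm]
    exact (ContinuousMap.dist_apply_le_dist x).trans hgD.le
  filter_upwards [Metric.tendsto_nhds.1 (h g hg) (ε / 3) (by positivity)] with i hi
  have h1 := key (μs i)
  have h2 := key μ
  rw [Real.dist_eq] at hi ⊢
  rw [abs_le] at h1 h2
  rw [abs_lt] at hi ⊢
  constructor <;> linarith

/-- The monomials `∏ f_j(x_j)` on a countable power. -/
def coordinateMonomials (K : Type*) [TopologicalSpace K] : Submonoid C(ℕ → K, ℝ) where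
  -- Requiring the formula for all `k ≥ N` lets two monomials be multiplied at a common length.
  carrier := {F | ∃ (f : ℕ → C(K, ℝ)) (N : ℕ), ∀ k ≥ N, ∀ x,
    F x = ∏ j ∈ Finset.range k, f j (x j)}
  one_mem' := ⟨fun _ => 1, 0, fun k _ x => by simp⟩
  mul_mem' := by
    rintro F G ⟨f, M, hf⟩ ⟨g, N, hg⟩
    refine ⟨fun j => f j * g j, max M N, fun k hk x => ?_⟩
    simp [hf k (le_of_max_le_left hk), hg k (le_of_max_le_right hk), Finset.prod_mul_distrib]

lemma separatesPoints_adjoin_coordinateMonomials (K : Type*) [TopologicalSpace K] [NormalSpace K]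
    [T1Space K] :
    (Algebra.adjoin ℝ (coordinateMonomials K : Set C(ℕ → K, ℝ))).SeparatesPoints := by
  intro x y hxy
  obtain ⟨i, hi⟩ := Function.ne_iff.1 hxy
  obtain ⟨g, hg0, hg1, -⟩ := exists_continuous_zero_one_of_isClosed
    (isClosed_singleton (x := x i)) (isClosed_singleton (x := y i)) (by simpa using hi)
  let F : C(ℕ → K, ℝ) := g.comp ⟨fun z => z i, continuous_apply i⟩
  refine ⟨F, ⟨F, Algebra.subset_adjoin ⟨Function.update (fun _ => 1) i g, i + 1,
    fun k hk z => ?_⟩, rfl⟩, ?_⟩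
  · rw [Finset.prod_eq_single i]
    · simp [F]
    · intro j _ hj
      simp [Function.update_of_ne hj]
    · intro h
      exact absurd (Finset.mem_range.2 hk) h
  · simp only [F, ContinuousMap.comp_apply, ContinuousMap.coe_mk]
    rw [hg0 rfl, hg1 rfl]
    simp

/-- On a countable power of a compact space, weak convergence can be tested on products of
functions of single coordinates. -/
lemma tendsto_probabilityMeasure_pi_of_compact {K : Type*} [TopologicalSpace K] [CompactSpace K]
    [T2Space K] [SecondCountableTopology K] [MeasurableSpace K] [BorelSpace K]
    {μs : ℕ → ProbabilityMeasure (ℕ → K)} {μ : ProbabilityMeasure (ℕ → K)}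
    (h : ∀ (k : ℕ) (f : ℕ → C(K, ℝ)),
      Tendsto (fun n => ∫ z, ∏ j ∈ Finset.range k, f j (z j) ∂(μs n : Measure (ℕ → K))) atTop
        (𝓝 (∫ z, ∏ j ∈ Finset.range k, f j (z j) ∂(μ : Measure (ℕ → K))))) :
    Tendsto μs atTop (𝓝 μ) := by
  have hd := ContinuousMap.subalgebra_topologicalClosure_eq_top_of_separatesPoints _
    (separatesPoints_adjoin_coordinateMonomials K)
  have hdense : Dense (Algebra.adjoin ℝ (coordinateMonomials K : Set C(ℕ → K, ℝ)) :
      Set C(ℕ → K, ℝ)) := by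
    rw [dense_iff_closure_eq, ← Subalgebra.topologicalClosure_coe, hd]
    rfl
  refine tendsto_probabilityMeasure_of_dense hdense fun F hF => ?_
  -- The monomials are closed under products, so the algebra they generate is their linear span and
  -- linearity suffices.
  have hF' : F ∈ Submodule.span ℝ (coordinateMonomials K : Set C(ℕ → K, ℝ)) := by
    have := Algebra.adjoin_eq_span ℝ (coordinateMonomials K : Set C(ℕ → K, ℝ))
    rw [Submonoid.closure_eq] at this
    rw [← this]
    exact hF
  clear hF
  induction hF' using Submodule.span_induction with
  | mem F hF =>
    obtain ⟨f, N, hf⟩ := hF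
    simp_rw [hf N le_rfl]
    exact h N f
  | zero => simp
  | add F G _ _ hF hG =>
    simp only [ContinuousMap.add_apply]
    simp_rw [integral_add (integrable_continuousMap _ F) (integrable_continuousMap _ G)]
    exact hF.add hG
  | smul c F _ hF =>
    simp only [ContinuousMap.smul_apply, smul_eq_mul, integral_const_mul]
    exact hF.const_mul c

lemma exists_isEmbedding_hilbertCube (S : Type*) [TopologicalSpace S]
    [TopologicalSpace.MetrizableSpace S] [SecondCountableTopology S] :
    ∃ ι : S → ℕ → unitInterval, IsEmbedding ι := by
  let := TopologicalSpace.metrizableSpaceMetric S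
  exact Metric.PiNatEmbed.exists_embedding_to_hilbert_cube

/-- On a countable power of a separable metrizable space, weak convergence can be tested on products
of bounded continuous functions of single coordinates. -/
lemma tendsto_probabilityMeasure_pi {S : Type*} [TopologicalSpace S]
    [TopologicalSpace.MetrizableSpace S] [SecondCountableTopology S] [MeasurableSpace S]
    [BorelSpace S] {μs : ℕ → ProbabilityMeasure (ℕ → S)} {μ : ProbabilityMeasure (ℕ → S)}
    (h : ∀ (k : ℕ) (f : Fin k → S →ᵇ ℝ),
      Tendsto (fun n => ∫ z, ∏ j, f j (z j) ∂(μs n : Measure (ℕ → S))) atTop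
        (𝓝 (∫ z, ∏ j, f j (z j) ∂(μ : Measure (ℕ → S))))) :
    Tendsto μs atTop (𝓝 μ) := by
  obtain ⟨ι, hι⟩ := exists_isEmbedding_hilbertCube S
  have hJ : IsInducing (Pi.map fun _ : ℕ => ι) := IsInducing.piMap fun _ => hι.isInducing
  refine tendsto_probabilityMeasure_of_tendsto_map hJ ?_
  refine tendsto_probabilityMeasure_pi_of_compact fun k f => ?_
  have key : ∀ ν : ProbabilityMeasure (ℕ → S),
      ∫ z, ∏ j ∈ Finset.range k, f j (z j)
        ∂(ν.map hJ.continuous.measurable.aemeasurable : Measure (ℕ → ℕ → unitInterval)) =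
      ∫ z, ∏ j : Fin k, (BoundedContinuousFunction.mkOfCompact (f j)).compContinuous
        ⟨ι, hι.continuous⟩ (z j) ∂(ν : Measure (ℕ → S)) := by
    intro ν
    rw [ProbabilityMeasure.toMeasure_map, integral_map hJ.continuous.measurable.aemeasurable]
    · simp [Finset.prod_range, Pi.map]
    · refine Continuous.aestronglyMeasurable ?_
      exact continuous_finsetProd _ fun j _ => (f j).continuous.comp (continuous_apply j)
  simp_rw [key]
  exact h k _

/-! ### Limits carried by `S` and measurable versions -/

/-- If the integrals of all bounded continuous functions against probability measures on `S`
converge, and `S` is embedded in a compact metrizable space `K`, then a weak limit in `K` is carried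
by `S`. -/
lemma measure_compl_range_eq_zero_of_tendsto {S K : Type*} [TopologicalSpace S]
    [TopologicalSpace.MetrizableSpace S] [MeasurableSpace S] [BorelSpace S] [TopologicalSpace K]
    [TopologicalSpace.MetrizableSpace K] [CompactSpace K] [MeasurableSpace K] [BorelSpace K]
    {ι : S → K} (hι : Continuous ι) (hιr : MeasurableSet (range ι))
    {μ : ℕ → ProbabilityMeasure S} {ν : ProbabilityMeasure K}
    (hν : Tendsto (fun n => (μ n).map hι.measurable.aemeasurable) atTop (𝓝 ν))
    (hconv : ∀ f : S →ᵇ ℝ, ∃ l, Tendsto (fun n => ∫ x, f x ∂(μ n : Measure S)) atTop (𝓝 l)) :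
    (ν : Measure K) (range ι)ᶜ = 0 := by
  let := TopologicalSpace.metrizableSpaceMetric K
  by_contra hne
  -- By inner regularity the charge outside `S` is seen on a compact `C`; the distance to `C`,
  -- positive on `S`, plays the role of `r`.
  obtain ⟨C, hCsub, hC, hCpos⟩ := hιr.compl.exists_lt_isCompact (pos_iff_ne_zero.2 hne)
  have hCne : C.Nonempty := nonempty_of_measure_ne_zero hCpos.ne'
  have hd : Continuous fun y => Metric.infDist y C := Metric.continuous_infDist_pt C
  have hr : Continuous fun x => Metric.infDist (ι x) C := hd.comp hι
  have hmap : ∀ n (A : Set K), MeasurableSet A →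
      (((μ n).map hι.measurable.aemeasurable : ProbabilityMeasure K) : Measure K) A =
        (μ n : Measure S) (ι ⁻¹' A) := fun n A hA => by
    rw [ProbabilityMeasure.toMeasure_map, Measure.map_apply hι.measurable hA]
  have hc : 0 < (ν : Measure K).real C := ENNReal.toReal_pos hCpos.ne' (measure_ne_top _ _)
  have hup : ∀ ε > 0, ∃ δ > 0, ∀ᶠ n in atTop,
      (μ n : Measure S).real {x | Metric.infDist (ι x) C ≤ δ} < (ν : Measure K).real C + ε := by
    intro ε hε
    have hlt : (ν : Measure K) C < ENNReal.ofReal ((ν : Measure K).real C + ε) := by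
      rw [← ENNReal.ofReal_toReal (measure_ne_top (ν : Measure K) C)]
      exact (ENNReal.ofReal_lt_ofReal_iff (by positivity)).2 (lt_add_of_pos_right _ hε)
    have hth := tendsto_measure_cthickening_of_isClosed (μ := (ν : Measure K)) (s := C)
      ⟨1, one_pos, measure_ne_top _ _⟩ hC.isClosed
    have hev := ((tendsto_order.1 hth).2 _ hlt).filter_mono (nhdsWithin_le_nhds (s := Ioi 0))
    obtain ⟨δ, hδ, hδ0⟩ := (hev.and self_mem_nhdsWithin).exists
    refine ⟨δ, hδ0, ?_⟩
    have hcl : IsClosed {y | Metric.infDist y C ≤ δ} := isClosed_le hd continuous_const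
    have hsub : {y | Metric.infDist y C ≤ δ} ⊆ Metric.cthickening δ C := fun y hy =>
      Metric.mem_cthickening_iff.2
        ((ENNReal.le_ofReal_iff_toReal_le (Metric.infEDist_ne_top hCne) (le_of_lt hδ0)).2 hy)
    have hlim := (ProbabilityMeasure.limsup_measure_closed_le_of_tendsto hν hcl).trans_lt
      ((measure_mono hsub).trans_lt hδ)
    filter_upwards [eventually_lt_of_limsup_lt hlim] with n hn
    rw [hmap n _ hcl.measurableSet] at hn
    exact ENNReal.toReal_lt_of_lt_ofReal hn
  have hlow : ∀ t > 0, ∀ ε > 0, ∀ᶠ n in atTop, (ν : Measure K).real C - ε <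
      (μ n : Measure S).real {x | Metric.infDist (ι x) C < t} := by
    intro t ht ε hε
    have hop : IsOpen {y | Metric.infDist y C < t} := isOpen_lt hd continuous_const
    have hsub : C ⊆ {y | Metric.infDist y C < t} := fun y hy => by
      simpa [Metric.infDist_zero_of_mem hy] using ht
    have hlt : ENNReal.ofReal ((ν : Measure K).real C - ε) < (ν : Measure K) C := by
      rw [← ENNReal.ofReal_toReal (measure_ne_top (ν : Measure K) C)]
      exact (ENNReal.ofReal_lt_ofReal_iff hc).2 (sub_lt_self _ hε)
    have hlim := (hlt.trans_le (measure_mono hsub)).trans_le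
      (ProbabilityMeasure.le_liminf_measure_open_of_tendsto hν hop)
    filter_upwards [eventually_lt_of_lt_liminf hlim] with n hn
    rw [hmap n _ hop.measurableSet] at hn
    by_contra hle
    refine hn.not_ge ?_
    rw [← ENNReal.ofReal_toReal (measure_ne_top (μ n : Measure S) _)]
    exact ENNReal.ofReal_le_ofReal (not_lt.1 hle)
  obtain ⟨f, hf⟩ := exists_not_tendsto_integral_of_escaping_mass (fun n => (μ n : Measure S)) hr
    (fun x => (hC.isClosed.notMem_iff_infDist_pos hCne).1 fun h => hCsub h (mem_range_self x))
    hc hup hlow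
  obtain ⟨l, hl⟩ := hconv f
  exact hf l hl

/-- A family of Borel probability measures is measurable if the integrals of bounded continuous
functions are. -/
lemma measurable_of_measurable_lintegral_bcf {Ω K : Type*} [MeasurableSpace Ω] [TopologicalSpace K]
    [HasOuterApproxClosed K] [MeasurableSpace K] [BorelSpace K] {b : Ω → ProbabilityMeasure K}
    (h : ∀ F : K →ᵇ NNReal, Measurable fun ω => ∫⁻ x, F x ∂(b ω : Measure K)) :
    Measurable fun ω => (b ω : Measure K) := by
  refine Measurable.measure_of_isPiSystem_of_isProbabilityMeasure
    (borel_eq_generateFrom_isClosed (α := K) ▸ BorelSpace.measurable_eq) isPiSystem_isClosed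
    fun F hF => ?_
  exact measurable_of_tendsto_metrizable (fun n => h (hF.apprSeq n))
    (tendsto_pi_nhds.2 fun ω => HasOuterApproxClosed.tendsto_lintegral_apprSeq hF (b ω : Measure K))

/-- An almost everywhere weak limit of random probability measures has a version that is a Markov
kernel. -/
lemma exists_kernel_of_ae_tendsto {Ω K : Type*} [MeasurableSpace Ω] {P : Measure Ω}
    [TopologicalSpace K] [HasOuterApproxClosed K] [MeasurableSpace K] [BorelSpace K]
    [Nonempty K] {p : ℕ → Ω → ProbabilityMeasure K}
    (hp : ∀ n, Measurable fun ω => (p n ω : Measure K))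
    (h : ∀ᵐ ω ∂P, ∃ β, Tendsto (fun n => p n ω) atTop (𝓝 β)) :
    ∃ b : Ω → ProbabilityMeasure K, Measurable (fun ω => (b ω : Measure K)) ∧
      ∀ᵐ ω ∂P, Tendsto (fun n => p n ω) atTop (𝓝 (b ω)) := by
  classical
  let N : Set Ω := {ω | ¬ ∃ β, Tendsto (fun n => p n ω) atTop (𝓝 β)}
  -- The exceptional set need not be measurable, so a measurable null hull takes its place, with a
  -- Dirac mass as default on it.
  let T : Set Ω := toMeasurable P N
  have hTm : MeasurableSet T := measurableSet_toMeasurable P N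
  have hT0 : P T = 0 := (measure_toMeasurable N).trans h
  have hT : ∀ ω, ω ∉ T → ∃ β, Tendsto (fun n => p n ω) atTop (𝓝 β) := fun ω hω =>
    not_not.1 fun hn => hω (subset_toMeasurable P N hn)
  obtain ⟨y⟩ := ‹Nonempty K›
  let b₀ : ProbabilityMeasure K := ⟨Measure.dirac y, inferInstance⟩
  let b : Ω → ProbabilityMeasure K := fun ω => if hω : ω ∈ T then b₀ else (hT ω hω).choose
  have hb : ∀ ω, ω ∉ T → Tendsto (fun n => p n ω) atTop (𝓝 (b ω)) := fun ω hω => by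
    simp only [b, dif_neg hω]
    exact (hT ω hω).choose_spec
  refine ⟨b, measurable_of_measurable_lintegral_bcf fun F => ?_, ?_⟩
  · refine measurable_of_tendsto_metrizable
      (f := fun n ω => if ω ∈ T then ∫⁻ x, F x ∂(b₀ : Measure K)
        else ∫⁻ x, F x ∂(p n ω : Measure K))
      (fun n => Measurable.ite hTm measurable_const ?_) (tendsto_pi_nhds.2 fun ω => ?_)
    · exact (Measure.measurable_lintegral
        (F.continuous.measurable.coe_nnreal_ennreal)).comp (hp n)
    · by_cases hω : ω ∈ T
      · simp only [if_pos hω, b, dif_pos hω]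
        exact tendsto_const_nhds
      · simp only [if_neg hω]
        exact ProbabilityMeasure.tendsto_iff_forall_lintegral_tendsto.1 (hb ω hω) F
  · filter_upwards [measure_eq_zero_iff_ae_notMem.1 hT0] with ω hω
    exact hb ω hω

/-! ### Existence of the limit and conclusion -/

section Existence

variable {Ω : Type v} [MeasurableSpace Ω] {P : Measure Ω} [IsProbabilityMeasure P]
  {S : Type u} [TopologicalSpace S] [TopologicalSpace.MetrizableSpace S]
  [SecondCountableTopology S] [MeasurableSpace S] [BorelSpace S] [StandardBorelSpace S]
  [Nonempty S] {X : ℕ → Ω → S}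

omit [TopologicalSpace.MetrizableSpace S] [SecondCountableTopology S] in
lemma integral_eq_integral_predictive (hX : ∀ n, Measurable (X n)) (n : ℕ) (f : S →ᵇ ℝ) :
    ∫ ω, f (X n ω) ∂P = ∫ ω, ∫ x, f x ∂predictive P X n ω ∂P := by
  simpa using integral_mul_eq_integral_mul_predictive P hX n f (Y := fun _ => 1) (C := 1)
    stronglyMeasurable_const (by simp)

/-- The predictive distributions have a limiting random probability measure. -/
theorem PredictivesConverge.exists_isPredictiveLimit (hX : ∀ n, Measurable (X n))
    (hconv : PredictivesConverge P X) :
    ∃ α : Kernel Ω S, IsMarkovKernel α ∧ IsPredictiveLimit P X α := by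
  obtain ⟨ι, hι⟩ := exists_isEmbedding_hilbertCube S
  have hιm : MeasurableEmbedding ι := hι.continuous.measurable.measurableEmbedding hι.injective
  have hιa : ∀ μ : Measure S, AEMeasurable ι μ := fun μ => hιm.measurable.aemeasurable
  let ρ : ℕ → Ω → ProbabilityMeasure S := fun n ω => ⟨predictive P X n ω, inferInstance⟩
  let p : ℕ → Ω → ProbabilityMeasure (ℕ → unitInterval) := fun n ω => (ρ n ω).map (hιa _)
  let pull : C(ℕ → unitInterval, ℝ) → S →ᵇ ℝ := fun F =>
    (BoundedContinuousFunction.mkOfCompact F).compContinuous ⟨ι, hι.continuous⟩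
  have hpull : ∀ (μ : ProbabilityMeasure S) (F : C(ℕ → unitInterval, ℝ)),
      ∫ y, F y ∂(μ.map (hιa _) : Measure (ℕ → unitInterval)) =
        ∫ x, pull F x ∂(μ : Measure S) := fun μ F => by
    rw [ProbabilityMeasure.toMeasure_map,
      integral_map (hιa _) F.continuous.aestronglyMeasurable]
    rfl
  have hUm : ∀ (f : S →ᵇ ℝ) n, AEStronglyMeasurable (fun ω => ∫ x, f x ∂predictive P X n ω) P :=
    fun f n => ((stronglyMeasurable_integral_predictive P X n f).mono
      (pastField_le hX n)).aestronglyMeasurable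
  obtain ⟨d, hd⟩ := TopologicalSpace.exists_dense_seq C(ℕ → unitInterval, ℝ)
  choose g hgm hg using fun k => hconv (pull (d k))
  obtain ⟨ns, hns, hae⟩ := exists_common_seq_tendsto_ae hg
  have hlim : ∀ᵐ ω ∂P, ∃ β, Tendsto (fun j => p (ns j) ω) atTop (𝓝 β) := by
    filter_upwards [hae] with ω hω
    -- Compactness supplies a cluster point; convergence on the dense functions forces the whole
    -- sequence to it.
    obtain ⟨β, φ, hφ, hβ⟩ := CompactSpace.tendsto_subseq fun j => p (ns j) ω
    refine ⟨β, tendsto_probabilityMeasure_of_dense (D := range d) hd ?_⟩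
    rintro _ ⟨k, rfl⟩
    have h1 : Tendsto (fun j => ∫ y, d k y ∂(p (ns j) ω : Measure (ℕ → unitInterval))) atTop
        (𝓝 (g k ω)) := by
      simp_rw [p, hpull]
      exact hω k
    have h2 := ProbabilityMeasure.tendsto_iff_forall_integral_tendsto.1 hβ
      (BoundedContinuousFunction.mkOfCompact (d k))
    rwa [tendsto_nhds_unique (h1.comp hφ.tendsto_atTop) h2] at h1
  have hpm : ∀ n, Measurable fun ω => (p n ω : Measure (ℕ → unitInterval)) := fun n =>
    (Measure.measurable_map ι hιm.measurable).comp (measurable_predictive P hX n)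
  obtain ⟨b, hbm, hb⟩ := exists_kernel_of_ae_tendsto (fun j => hpm (ns j)) hlim
  let κ : Kernel Ω (ℕ → unitInterval) := ⟨fun ω => (b ω : Measure (ℕ → unitInterval)), hbm⟩
  have : IsMarkovKernel κ :=
    ⟨fun ω => inferInstanceAs (IsProbabilityMeasure (b ω : Measure (ℕ → unitInterval)))⟩
  let ν : ProbabilityMeasure (ℕ → unitInterval) := ⟨P.bind κ, inferInstance⟩
  -- These laws are the means of the predictives, which reduces the question of support to
  -- deterministic measures.
  let μ : ℕ → ProbabilityMeasure S := fun j =>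
    ⟨P.map (X (ns j)), Measure.isProbabilityMeasure_map (hX _).aemeasurable⟩
  have hμ : ∀ j (f : S →ᵇ ℝ), ∫ x, f x ∂(μ j : Measure S) =
      ∫ ω, ∫ x, f x ∂predictive P X (ns j) ω ∂P := fun j f => by
    rw [← integral_eq_integral_predictive hX]
    exact integral_map (hX _).aemeasurable f.continuous.aestronglyMeasurable
  have hμν : Tendsto (fun j => (μ j).map (hιa _)) atTop (𝓝 ν) := by
    refine tendsto_probabilityMeasure_of_dense (D := univ) dense_univ fun F _ => ?_
    have hν : ∫ y, F y ∂(ν : Measure (ℕ → unitInterval)) =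
        ∫ ω, ∫ y, F y ∂(b ω : Measure (ℕ → unitInterval)) ∂P :=
      integral_bind_kernel (integrable_continuousMap (P.bind κ) F)
    rw [hν]
    simp_rw [hpull, hμ]
    refine tendsto_integral_of_dominated_convergence (fun _ => ‖pull F‖)
      (fun j => hUm _ _) (integrable_const _)
      (fun j => Eventually.of_forall fun ω => abs_integral_bcf_le _ _) ?_
    filter_upwards [hb] with ω hω
    have := ProbabilityMeasure.tendsto_iff_forall_integral_tendsto.1 hω
      (BoundedContinuousFunction.mkOfCompact F)
    refine this.congr fun j => ?_
    exact hpull (ρ (ns j) ω) F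
  have hν0 : (ν : Measure (ℕ → unitInterval)) (range ι)ᶜ = 0 := by
    refine measure_compl_range_eq_zero_of_tendsto hι.continuous hιm.measurableSet_range hμν
      fun f => ?_
    obtain ⟨G, -, hG⟩ := hconv f
    refine ⟨∫ ω, G ω ∂P, ?_⟩
    simp_rw [hμ]
    exact (tendsto_integral_of_tendstoInMeasure (hUm f)
      (fun n ω => abs_integral_bcf_le _ f) hG).comp hns.tendsto_atTop
  have hκ0 : ∀ᵐ ω ∂P, κ ω (range ι)ᶜ = 0 := by
    have : ∀ᵐ y ∂(P.bind κ), y ∈ range ι := hν0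
    exact Measure.ae_ae_of_ae_comp this
  let R : Set Ω := {ω | κ ω (range ι)ᶜ = 0}
  have hR : MeasurableSet R :=
    (Kernel.measurable_coe κ hιm.measurableSet_range.compl) (measurableSet_singleton 0)
  classical
  obtain ⟨s₀⟩ := ‹Nonempty S›
  -- A Dirac mass on the null set where `κ ω` charges the complement of `range ι` makes `α` Markov
  -- everywhere.
  let α : Kernel Ω S :=
    Kernel.piecewise hR (Kernel.comapRight κ hιm) (Kernel.const Ω (Measure.dirac s₀))
  have hαR : ∀ ω ∈ R, α ω = (κ ω).comap ι := fun ω hω => by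
    simp only [α, Kernel.piecewise_apply, if_pos hω, Kernel.comapRight_apply]
  have hαmap : ∀ ω ∈ R, (α ω).map ι = κ ω := fun ω hω => by
    rw [hαR ω hω, hιm.map_comap]
    exact Measure.restrict_eq_self_of_ae_mem hω
  have hα : IsMarkovKernel α := by
    refine ⟨fun ω => ?_⟩
    by_cases hω : ω ∈ R
    · have : IsProbabilityMeasure ((α ω).map ι) := hαmap ω hω ▸ inferInstance
      exact Measure.isProbabilityMeasure_of_map ι
    · simp only [α, Kernel.piecewise_apply, if_neg hω, Kernel.const_apply]
      infer_instance
  refine ⟨α, hα, fun f => ?_⟩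
  obtain ⟨G, -, hG⟩ := hconv f
  have hsub : TendstoInMeasure P (fun j ω => ∫ x, f x ∂predictive P X (ns j) ω) atTop
      fun ω => ∫ x, f x ∂α ω := by
    refine tendstoInMeasure_of_tendsto_ae (fun j => hUm f (ns j)) ?_
    filter_upwards [hb, hκ0] with ω hω hωR
    let a : ProbabilityMeasure S := ⟨α ω, inferInstance⟩
    have hw : Tendsto (fun j => ρ (ns j) ω) atTop (𝓝 a) := by
      refine tendsto_probabilityMeasure_of_tendsto_map hι.isInducing ?_
      have e : a.map (hιa _) = b ω :=
        Subtype.ext (hαmap ω hωR)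
      rw [e]
      exact hω
    exact ProbabilityMeasure.tendsto_iff_forall_integral_tendsto.1 hw f
  -- The full sequence already has a limit `G` in probability; the subsequence only identifies it.
  exact hG.congr_right (tendstoInMeasure_ae_unique (hG.comp hns.tendsto_atTop) hsub)

/-- The shifted sequence converges in distribution to the mixture directed by the limit of the
predictive distributions. -/
theorem IsPredictiveLimit.tendstoInDistribution (hX : ∀ n, Measurable (X n)) {α : Kernel Ω S}
    [IsMarkovKernel α] (hα : IsPredictiveLimit P X α) :
    TendstoInDistribution (fun (n : ℕ) (ω : Ω) (i : ℕ) => X (n + i) ω) atTop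
      (fun (z : ℕ → S) (i : ℕ) => z i) (fun _ => P) (P.bind (iidKernel α)) := by
  have hXm : ∀ n, Measurable fun (ω : Ω) (i : ℕ) => X (n + i) ω := fun n =>
    measurable_pi_lambda _ fun i => hX _
  refine ⟨fun n => (hXm n).aemeasurable, measurable_id.aemeasurable, ?_⟩
  refine tendsto_probabilityMeasure_pi fun k f => ?_
  have hfm : ∀ μ : Measure (ℕ → S), AEStronglyMeasurable (fun z => ∏ j, f j (z j)) μ := fun μ =>
    (continuous_finsetProd _ fun j _ =>
      (f j).continuous.comp (continuous_apply _)).aestronglyMeasurable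
  have h := hα.tendsto_integral_prod hX f
  rw [← integral_prod_bind_iidKernel] at h
  simp only [ProbabilityMeasure.coe_mk]
  rw [show Measure.map (fun (z : ℕ → S) i => z i) (P.bind (iidKernel α)) = P.bind (iidKernel α)
    from Measure.map_id]
  refine h.congr fun n => ?_
  rw [integral_map (hXm n).aemeasurable (hfm _)]

end Existence

theorem mainTheorem3 {Ω : Type v} [MeasurableSpace Ω] (P : Measure Ω) [IsProbabilityMeasure P]
    {S : Type u} [TopologicalSpace S] [TopologicalSpace.MetrizableSpace S]
    [SecondCountableTopology S] [MeasurableSpace S] [BorelSpace S] [StandardBorelSpace S]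
    [Nonempty S]
    (X : ℕ → Ω → S) (hX : ∀ n, Measurable (X n)) (hconv : PredictivesConverge P X) :
    AsymptoticallyExchangeable P X ∧
    (∃ α : Kernel Ω S, IsMarkovKernel α ∧ IsPredictiveLimit P X α) ∧
    (∀ α : Kernel Ω S, IsMarkovKernel α → IsPredictiveLimit P X α →
      ∃ (Ω' : Type u) (_ : MeasurableSpace Ω') (Q : Measure Ω') (_ : IsProbabilityMeasure Q)
        (Z : ℕ → Ω' → S), (∀ i, Measurable (Z i)) ∧ Exchangeable Q Z ∧ IsIIDMixture P α Q Z ∧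
          TendstoInDistribution (fun (n : ℕ) (ω : Ω) (i : ℕ) => X (n + i) ω) atTop
            (fun (ω' : Ω') (i : ℕ) => Z i ω') (fun _ => P) Q) := by
  have hmix : ∀ α : Kernel Ω S, IsMarkovKernel α → IsPredictiveLimit P X α →
      ∃ (Ω' : Type u) (_ : MeasurableSpace Ω') (Q : Measure Ω') (_ : IsProbabilityMeasure Q)
        (Z : ℕ → Ω' → S), (∀ i, Measurable (Z i)) ∧ Exchangeable Q Z ∧ IsIIDMixture P α Q Z ∧
          TendstoInDistribution (fun (n : ℕ) (ω : Ω) (i : ℕ) => X (n + i) ω) atTop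
            (fun (ω' : Ω') (i : ℕ) => Z i ω') (fun _ => P) Q := fun α _ hα =>
    ⟨ℕ → S, inferInstance, P.bind (iidKernel α), inferInstance, fun i z => z i,
      fun i => measurable_pi_apply i,
      (isIIDMixture_bind_iidKernel P α).exchangeable fun i => measurable_pi_apply i,
      isIIDMixture_bind_iidKernel P α, hα.tendstoInDistribution hX⟩
  obtain ⟨α, hα, hlim⟩ := hconv.exists_isPredictiveLimit hX
  obtain ⟨Ω', m, Q, hQ, Z, -, hex, -, htend⟩ := hmix α hα hlim
  exact ⟨⟨Ω', m, Q, hQ, Z, hex, htend⟩, ⟨α, hα, hlim⟩, hmix⟩
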